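/- Let $N,T\ge 1$. In the experts setting the decision set is the simplex $\Delta^N=\{w\in\mathbb R^N: w_i\ge 0,\ \sum_i w_i=1\}$ and the reward vectors are $\theta_1,\dots,\theta_T\in\mathbb R^N$ with $\|\theta_t\|_\infty\le 1$. Put $\Theta_t=\sum_{s=1}^t\theta_s$ and let $\Phi(\Theta)=\max_{w\in\Delta^N}\langle w,\Theta\rangle$ be the baseline potential. For a scale $\eta>0$ let $$\tilde\Phi(\Theta;\eta)=\mathbb E_{u\sim\mathcal N(0,I)}\,\Phi(\Theta+\eta u)$$ be its Gaussian smoothing. Each $\tilde\Phi(\cdot\,;\eta)$, $\eta>0$, is differentiable on $\mathbb R^N$ with all its gradients in $\Delta^N$, so the gradient-based prediction algorithm (GBPA) with scales $\eta_1,\dots,\eta_T>0$, which in round $t$ plays $w_t=\nabla\tilde\Phi(\cdot\,;\eta_t)$ evaluated at $\Theta_{t-1}$ and then receives the reward $\langle w_t,\theta_t\rangle$, is well defined. Its regret is $\mathrm{Regret}=\Phi(\Theta_T)-\sum_{t=1}^T\langle w_t,\theta_t\rangle$. For all reward vectors as above the following hold. 1. If $0<\eta_1\le\eta_2\le\dots\le\eta_T$,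 then $$\mathrm{Regret}\le\sqrt{2\log N}\,\Big(\eta_T+\sum_{t=1}^T\frac1{\eta_t}\|\theta_t\|_\infty^2\Big).$$ 2. If $\eta_t=\sqrt{\sum_{s=1}^T\|\theta_s\|_\infty^2}$ for all $t$ (tuned in hindsight), then $$\mathrm{Regret}\le 2\sqrt{2\sum_{t=1}^T\|\theta_t\|_\infty^2\,\log N}.$$ (If the sum is $0$, all rewards vanish and the regret is $0$ whatever is played.) 3. If $\eta_t=\sqrt{2\big(1+\sum_{s=1}^{t-1}\|\theta_s\|_\infty^2\big)}$ for all $t$ (chosen adaptively), then $$\mathrm{Regret}\le 4\sqrt{\Big(1+\sum_{t=1}^T\|\theta_t\|_\infty^2\Big)\log N}.$$ -/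

import Mathlib

open MeasureTheory ProbabilityTheory
open scoped RealInnerProductSpace

noncomputable section

namespace OnlineLinearOptimization

/-- The decision set of the experts setting: the probability simplex in `ℝ^N`. -/
def simplex (N : ℕ) : Set (EuclideanSpace ℝ (Fin N)) :=
  {w | (∀ i, 0 ≤ w i) ∧ ∑ i, w i = 1}

/-- The `ℓ_∞` norm of a vector. (The norm of the product type `Fin N → ℝ` is the sup norm.) -/
def linftyNorm {N : ℕ} (v : EuclideanSpace ℝ (Fin N)) : ℝ := ‖(WithLp.ofLp v : Fin N → ℝ)‖

/-- The reward set of the experts setting: the closed unit ball of the `ℓ_∞` norm. -/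
def expertsRewardSet (N : ℕ) : Set (EuclideanSpace ℝ (Fin N)) := {v | linftyNorm v ≤ 1}

/-- The baseline potential `Φ(Θ) = max_{w ∈ X} ⟨w, Θ⟩` of a decision set `X`. It is used for
nonempty compact `X`, where the supremum is attained. -/
def baselinePotential {N : ℕ} (X : Set (EuclideanSpace ℝ (Fin N)))
    (Θ : EuclideanSpace ℝ (Fin N)) : ℝ :=
  sSup ((fun w => ⟪w, Θ⟫) '' X)

/-- The cumulative reward vector `Θ_t = θ_1 + ⋯ + θ_t`; in particular `Θ_0 = 0`. -/
def cumReward {N : ℕ} (θ : ℕ → EuclideanSpace ℝ (Fin N)) (t : ℕ) : EuclideanSpace ℝ (Fin N) :=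
  ∑ s ∈ Finset.Icc 1 t, θ s

/-- The regret, against the best fixed decision in `X`, of the decisions `w_1, …, w_T` when the
reward vectors are `θ_1, …, θ_T`. -/
def regret {N : ℕ} (X : Set (EuclideanSpace ℝ (Fin N))) (T : ℕ)
    (w θ : ℕ → EuclideanSpace ℝ (Fin N)) : ℝ :=
  baselinePotential X (cumReward θ T) - ∑ t ∈ Finset.Icc 1 T, ⟪w t, θ t⟫

/-- The potentials which the gradient-based prediction algorithm may use: differentiable functions
on the whole space, all of whose gradients are decisions. -/
def IsAdmissiblePotential {N : ℕ} (X : Set (EuclideanSpace ℝ (Fin N)))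
    (Ψ : EuclideanSpace ℝ (Fin N) → ℝ) : Prop :=
  Differentiable ℝ Ψ ∧ ∀ Θ, gradient Ψ Θ ∈ X

/-- The decision `w_t = ∇Φ_t(Θ_{t-1})` of the gradient-based prediction algorithm in round
`t ≥ 1`, where `Φ_t` is the potential used in round `t`. -/
def gbpaPlay {N : ℕ} (Φ : ℕ → EuclideanSpace ℝ (Fin N) → ℝ)
    (θ : ℕ → EuclideanSpace ℝ (Fin N)) (t : ℕ) : EuclideanSpace ℝ (Fin N) :=
  gradient (Φ t) (cumReward θ (t - 1))

/-- The Gaussian smoothing `Φ̃(Θ; η, N(0, S)) = 𝔼_{u ∼ N(0, S)} Φ(Θ + η u)`. -/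
def gaussianSmoothing {N : ℕ} (Φ : EuclideanSpace ℝ (Fin N) → ℝ) (η : ℝ)
    (S : Matrix (Fin N) (Fin N) ℝ) (Θ : EuclideanSpace ℝ (Fin N)) : ℝ :=
  ∫ u, Φ (Θ + η • u) ∂(multivariateGaussian 0 S)

/-- The smoothing with scale `η` and noise `N(0, I)` of the baseline potential of the experts
setting. -/
def expertsPotential (N : ℕ) (η : ℝ) : EuclideanSpace ℝ (Fin N) → ℝ :=
  gaussianSmoothing (baselinePotential (simplex N)) η 1

/-- The regret over `T` rounds, in the experts setting, of the gradient-based prediction algorithm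
run with the Gaussian smoothing of scale `η t` in round `t`, on the reward vectors `θ`. -/
def expertsRegret (N T : ℕ) (η : ℕ → ℝ) (θ : ℕ → EuclideanSpace ℝ (Fin N)) : ℝ :=
  regret (simplex N) T (gbpaPlay (fun t => expertsPotential N (η t)) θ) θ

end OnlineLinearOptimization

end

/-!
The regret is bounded by the potential method. Let `Φ` be the maximum of the coordinates, and let
the *leader* of a vector be its first maximal coordinate, so that `Φ y = y (leader y)`. For `u`
standard Gaussian let `leaderLaw η Θ` be the law of the leader of `Θ + η u`. It is a point of the
simplex, and a subgradient at `Θ` of the smoothed potential `Φ̃(·; η)`.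

The main point is that this subgradient varies slowly (`inner_leaderLaw_add_smul_le`). By the
Cameron–Martin formula `map_add_stdGaussian`, a translation of the noise can be moved to the
Gaussian density, whence, although the leader jumps,
`d/ds ⟪leaderLaw η (Θ + s v), v⟫ = η⁻¹ 𝔼[v_L ⟪v, u⟫]`, where `L` is the leader of
`Θ + s v + η u`. The right-hand side is `η⁻¹ v ⬝ A v` with `A i j = 𝔼[1{L = i} u_j]`. For `i ≠ j`,
raising `u_j` can only stop `i` from leading, so `A i j ≤ 0`; the columns of `A` sum to
`𝔼 u_j = 0`; and the trace of `A` is `𝔼 u_L ≤ 𝔼 max_i u_i`. So the absolute values of the entries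
of `A` sum to at most `2 𝔼 max_i u_i`, and `|v ⬝ A v| ≤ 2 𝔼[max_i u_i] ‖v‖_∞²`.

A convex function whose subgradients vary in this Lipschitz way is differentiable, with gradient
`leaderLaw` (`hasGradientAt_expertsPotential`); no discussion of ties is needed. Integrating once
more, `Φ̃` exceeds its tangent by at most `𝔼[max_i u_i] ‖v‖_∞² / η` (`expertsPotential_add_le`).

Raising the scale from `η` to `η'` costs at most `(η' - η) 𝔼 max_i u_i`, as `Φ` is sublinear, and
`Φ ≤ Φ̃` by Jensen's inequality. These estimates add up over the rounds
(`expertsPotential_sub_sum_le`), and `𝔼 max_i u_i ≤ √(2 log N)` (`gaussianMax_le`) gives the bound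
for non-decreasing scales. The other two bounds are special cases. For the adaptive scales, with
`x_t = 1 + ∑_{s ≤ t} ‖θ_s‖_∞²`, the sum `∑ (x_t - x_{t-1}) / √x_{t-1}` is at most `2 √x_T`
(`sum_div_sqrt_le`).
-/

open MeasureTheory ProbabilityTheory
open scoped RealInnerProductSpace

namespace OnlineLinearOptimization

/-! ### Translations and reflections of the standard Gaussian -/

section Gaussian

variable {N : ℕ}

lemma integrable_exp_inner_stdGaussian (w : EuclideanSpace ℝ (Fin N)) (r : ℝ) :
    Integrable (fun u => Real.exp (r * ⟪w, u⟫)) (stdGaussian (EuclideanSpace ℝ (Fin N))) := by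
  have h := (integrable_exp_mul_gaussianReal
    (μ := (stdGaussian (EuclideanSpace ℝ (Fin N)))[innerSL ℝ w])
    (v := (Var[innerSL ℝ w; stdGaussian (EuclideanSpace ℝ (Fin N))]).toNNReal) r)
  rw [← IsGaussian.map_eq_gaussianReal, integrable_map_measure (by fun_prop) (by fun_prop)] at h
  exact h

lemma integrable_apply_stdGaussian (i : Fin N) :
    Integrable (fun u : EuclideanSpace ℝ (Fin N) => u i)
      (stdGaussian (EuclideanSpace ℝ (Fin N))) :=
  (EuclideanSpace.proj (𝕜 := ℝ) i).integrable_comp IsGaussian.integrable_id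

lemma integral_apply_stdGaussian (i : Fin N) :
    ∫ u : EuclideanSpace ℝ (Fin N), u i ∂(stdGaussian (EuclideanSpace ℝ (Fin N))) = 0 :=
  integral_strongDual_stdGaussian (EuclideanSpace.proj (𝕜 := ℝ) i)

lemma measurePreserving_apply_stdGaussian (i : Fin N) :
    MeasurePreserving (fun u : EuclideanSpace ℝ (Fin N) => u i)
      (stdGaussian (EuclideanSpace ℝ (Fin N))) (gaussianReal 0 1) := by
  have h := measurePreserving_eval_multivariateGaussian
    (μ := (0 : EuclideanSpace ℝ (Fin N))) (S := 1) Matrix.PosSemidef.one (i := i)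
  simpa using h

/-- The exponential moments of the standard Gaussian, with a complex exponent. -/
lemma integral_cexp_stdGaussian (z : Fin N → ℂ) :
    ∫ u : EuclideanSpace ℝ (Fin N), Complex.exp (∑ i, z i * (u i : ℂ))
      ∂(stdGaussian (EuclideanSpace ℝ (Fin N))) = Complex.exp (∑ i, z i ^ 2 / 2) := by
  rw [← map_pi_eq_stdGaussian, integral_map (by fun_prop)
    (Measurable.aestronglyMeasurable (by fun_prop))]
  simp_rw [Complex.exp_sum]
  rw [integral_fintype_prod_eq_prod (f := fun i (x : ℝ) => Complex.exp (z i * (x : ℂ)))]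
  refine Finset.prod_congr rfl fun i _ => ?_
  have h := complexMGF_id_gaussianReal (μ := 0) (v := 1) (z i)
  simpa [complexMGF] using h

/-- The Cameron–Martin formula: translating the standard Gaussian by `w` multiplies it by the
density `u ↦ exp (⟪w, u⟫ - ‖w‖² / 2)`. -/
lemma map_add_stdGaussian (w : EuclideanSpace ℝ (Fin N)) :
    (stdGaussian (EuclideanSpace ℝ (Fin N))).map (fun u => u + w) =
      (stdGaussian (EuclideanSpace ℝ (Fin N))).withDensity
        (fun u => ENNReal.ofReal (Real.exp (⟪w, u⟫ - ‖w‖ ^ 2 / 2))) := by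
  have hint : Integrable (fun u => Real.exp (⟪w, u⟫ - ‖w‖ ^ 2 / 2))
      (stdGaussian (EuclideanSpace ℝ (Fin N))) := by
    have h := (integrable_exp_inner_stdGaussian w 1).mul_const (Real.exp (-(‖w‖ ^ 2 / 2)))
    simpa [← Real.exp_add, sub_eq_add_neg] using h
  have : IsFiniteMeasure ((stdGaussian (EuclideanSpace ℝ (Fin N))).withDensity
        (fun u => ENNReal.ofReal (Real.exp (⟪w, u⟫ - ‖w‖ ^ 2 / 2)))) :=
    isFiniteMeasure_withDensity_ofReal hint.2
  have : IsFiniteMeasure ((stdGaussian (EuclideanSpace ℝ (Fin N))).map (fun u => u + w)) :=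
    Measure.isFiniteMeasure_map _ _
  refine Measure.ext_of_charFun (E := EuclideanSpace ℝ (Fin N)) ?_
  ext t
  rw [charFun_apply, charFun_apply, integral_map (by fun_prop)
    (Measurable.aestronglyMeasurable (by fun_prop)),
    integral_withDensity_eq_integral_toReal_smul (by fun_prop) (by simp)]
  have h1 : ∀ u : EuclideanSpace ℝ (Fin N), Complex.exp (⟪u + w, t⟫ * Complex.I) =
      Complex.exp (∑ i, (t i * Complex.I) * (u i : ℂ)) * Complex.exp (⟪w, t⟫ * Complex.I) := by
    intro u
    rw [← Complex.exp_add, inner_add_left]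
    congr 1
    simp only [PiLp.inner_apply, RCLike.inner_apply, conj_trivial]
    push_cast
    rw [add_mul, Finset.sum_mul]
    congr 1
    exact Finset.sum_congr rfl fun i _ => by ring
  have h2 : ∀ u : EuclideanSpace ℝ (Fin N),
      (ENNReal.ofReal (Real.exp (⟪w, u⟫ - ‖w‖ ^ 2 / 2))).toReal •
        Complex.exp (⟪u, t⟫ * Complex.I) =
      Complex.exp (∑ i, (w i + t i * Complex.I) * (u i : ℂ)) *
        Complex.exp (-(‖w‖ ^ 2 / 2 : ℝ)) := by
    intro u
    rw [ENNReal.toReal_ofReal (Real.exp_pos _).le, Complex.real_smul, Complex.ofReal_exp,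
      ← Complex.exp_add, ← Complex.exp_add]
    congr 1
    simp only [PiLp.inner_apply, RCLike.inner_apply, conj_trivial]
    push_cast
    rw [Finset.sum_mul, sub_add_eq_add_sub, ← Finset.sum_add_distrib, sub_eq_add_neg]
    congr 1
    exact Finset.sum_congr rfl fun i _ => by ring
  simp_rw [h1, h2]
  rw [integral_mul_const, integral_mul_const, integral_cexp_stdGaussian, integral_cexp_stdGaussian,
    ← Complex.exp_add, ← Complex.exp_add, EuclideanSpace.real_norm_sq_eq]
  congr 1
  simp only [PiLp.inner_apply, RCLike.inner_apply, conj_trivial]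
  push_cast
  rw [Finset.sum_mul, ← Finset.sum_add_distrib, Finset.sum_div, ← Finset.sum_neg_distrib,
    ← Finset.sum_add_distrib]
  refine Finset.sum_congr rfl fun i _ => ?_
  ring_nf

lemma integral_comp_add_stdGaussian (f : EuclideanSpace ℝ (Fin N) → ℝ) (hf : Measurable f)
    (w : EuclideanSpace ℝ (Fin N)) :
    ∫ u, f (u + w) ∂(stdGaussian (EuclideanSpace ℝ (Fin N))) =
      ∫ u, Real.exp (⟪w, u⟫ - ‖w‖ ^ 2 / 2) * f u ∂(stdGaussian (EuclideanSpace ℝ (Fin N))) := by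
  rw [← integral_map (φ := fun u => u + w) (by fun_prop) hf.aestronglyMeasurable,
    map_add_stdGaussian, integral_withDensity_eq_integral_toReal_smul (by fun_prop) (by simp)]
  simp [ENNReal.toReal_ofReal (Real.exp_pos _).le]

/-- Gaussian integration by parts for a merely bounded `f`: the derivative falls on the density, so
that `f` need not be continuous. -/
lemma hasDerivAt_integral_comp_add_smul_stdGaussian (f : EuclideanSpace ℝ (Fin N) → ℝ)
    (hf : Measurable f) {C : ℝ} (hC : ∀ u, |f u| ≤ C) (w : EuclideanSpace ℝ (Fin N)) :
    HasDerivAt (fun s : ℝ => ∫ u, f (u + s • w) ∂(stdGaussian (EuclideanSpace ℝ (Fin N))))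
      (∫ u, f u * ⟪w, u⟫ ∂(stdGaussian (EuclideanSpace ℝ (Fin N)))) 0 := by
  have hC0 : 0 ≤ C := (abs_nonneg _).trans (hC 0)
  have heq : (fun s : ℝ => ∫ u, f (u + s • w) ∂(stdGaussian (EuclideanSpace ℝ (Fin N)))) =
      fun s : ℝ => ∫ u, Real.exp (s * ⟪w, u⟫ - s ^ 2 * ‖w‖ ^ 2 / 2) * f u
        ∂(stdGaussian (EuclideanSpace ℝ (Fin N))) := by
    ext s
    rw [integral_comp_add_stdGaussian f hf]
    simp [real_inner_smul_left, norm_smul, mul_pow]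
  rw [heq]
  have h := hasDerivAt_integral_of_dominated_loc_of_deriv_le
    (μ := stdGaussian (EuclideanSpace ℝ (Fin N)))
    (F := fun (s : ℝ) u => Real.exp (s * ⟪w, u⟫ - s ^ 2 * ‖w‖ ^ 2 / 2) * f u)
    (F' := fun (s : ℝ) u => Real.exp (s * ⟪w, u⟫ - s ^ 2 * ‖w‖ ^ 2 / 2) *
      (⟪w, u⟫ - s * ‖w‖ ^ 2) * f u)
    (bound := fun u => (1 + ‖w‖ ^ 2) * C *
      (Real.exp (2 * ⟪w, u⟫) + Real.exp ((-2) * ⟪w, u⟫)))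
    (x₀ := 0) (s := Metric.ball 0 1) (Metric.ball_mem_nhds _ one_pos)
    (Filter.Eventually.of_forall fun s => by fun_prop)
    ?_ (by fun_prop) ?_ ?_ ?_
  · simpa [mul_comm] using h.2
  · refine Integrable.of_bound (by fun_prop) C (Filter.Eventually.of_forall fun u => ?_)
    simpa using hC u
  · refine Filter.Eventually.of_forall fun u s hs => ?_
    have hs : |s| < 1 := by simpa using hs
    set x := ⟪w, u⟫
    set c := ‖w‖ ^ 2
    have hc : 0 ≤ c := by positivity
    rw [Real.norm_eq_abs, abs_mul, abs_mul, abs_of_pos (Real.exp_pos _)]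
    have h1 : Real.exp (s * x - s ^ 2 * c / 2) ≤ Real.exp |x| := by
      apply Real.exp_le_exp.2
      have : s * x ≤ |x| := (le_abs_self _).trans (by
        rw [abs_mul]; exact mul_le_of_le_one_left (abs_nonneg _) hs.le)
      nlinarith [mul_nonneg (sq_nonneg s) hc]
    have h2 : |x - s * c| ≤ (1 + c) * Real.exp |x| := by
      have h3 : |x - s * c| ≤ |x| + c := (abs_sub _ _).trans (by
        rw [abs_mul, abs_of_nonneg hc]
        have := mul_le_of_le_one_left hc hs.le
        linarith)
      have h4 : |x| ≤ Real.exp |x| := by linarith [Real.add_one_le_exp |x|]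
      have h5 : 1 ≤ Real.exp |x| := Real.one_le_exp (abs_nonneg _)
      nlinarith
    have h6 : Real.exp |x| * Real.exp |x| ≤ Real.exp (2 * x) + Real.exp ((-2) * x) := by
      rw [← Real.exp_add]
      rcases abs_cases x with ⟨h, _⟩ | ⟨h, _⟩ <;> rw [h]
      · rw [← two_mul]; linarith [Real.exp_pos ((-2) * x)]
      · rw [← two_mul, show 2 * -x = -2 * x by ring]; linarith [Real.exp_pos (2 * x)]
    calc _ ≤ Real.exp |x| * ((1 + c) * Real.exp |x|) * C := by
          gcongr
          exact hC u
      _ = (1 + c) * C * (Real.exp |x| * Real.exp |x|) := by ring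
      _ ≤ _ := by gcongr
  · exact ((integrable_exp_inner_stdGaussian w 2).add
      (integrable_exp_inner_stdGaussian w (-2))).const_mul _
  · refine Filter.Eventually.of_forall fun u s _ => ?_
    have h1 : HasDerivAt (fun s : ℝ => s * ⟪w, u⟫ - s ^ 2 * ‖w‖ ^ 2 / 2)
        (⟪w, u⟫ - s * ‖w‖ ^ 2) s := by
      have := ((hasDerivAt_id s).mul_const ⟪w, u⟫).sub
        ((((hasDerivAt_id s).pow 2).mul_const (‖w‖ ^ 2)).div_const 2)
      refine this.congr_deriv ?_
      simp only [id, Nat.cast_ofNat]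
      ring
    exact (h1.exp).mul_const _

/-- The reflection `u_j ↦ -u_j` of one coordinate. -/
noncomputable def coordReflection (j : Fin N) :
    EuclideanSpace ℝ (Fin N) ≃ₗᵢ[ℝ] EuclideanSpace ℝ (Fin N) :=
  LinearIsometryEquiv.piLpCongrRight 2
    (fun i => if i = j then LinearIsometryEquiv.neg ℝ else LinearIsometryEquiv.refl ℝ ℝ)

lemma coordReflection_apply_self (j : Fin N) (u : EuclideanSpace ℝ (Fin N)) :
    coordReflection j u j = -u j := by
  simp [coordReflection]

lemma coordReflection_apply_of_ne {i j : Fin N} (h : i ≠ j) (u : EuclideanSpace ℝ (Fin N)) :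
    coordReflection j u i = u i := by
  simp [coordReflection, h]

lemma integral_comp_coordReflection (j : Fin N) (f : EuclideanSpace ℝ (Fin N) → ℝ) :
    ∫ u, f (coordReflection j u) ∂(stdGaussian (EuclideanSpace ℝ (Fin N))) =
      ∫ u, f u ∂(stdGaussian (EuclideanSpace ℝ (Fin N))) :=
  MeasurePreserving.integral_comp
    (⟨(coordReflection j).continuous.measurable, stdGaussian_map (coordReflection j)⟩)
    (coordReflection j).toHomeomorph.measurableEmbedding f

/-- A bounded function that is antitone in `u_j` is negatively correlated with `u_j`. -/
lemma integral_mul_apply_nonpos (j : Fin N) (f : EuclideanSpace ℝ (Fin N) → ℝ)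
    (hf : Measurable f) {C : ℝ} (hC : ∀ u, |f u| ≤ C)
    (hanti : ∀ u v : EuclideanSpace ℝ (Fin N), u j ≤ v j → (∀ k, k ≠ j → u k = v k) → f v ≤ f u) :
    ∫ u, f u * u j ∂(stdGaussian (EuclideanSpace ℝ (Fin N))) ≤ 0 := by
  have hi : Integrable (fun u => f u * u j) (stdGaussian (EuclideanSpace ℝ (Fin N))) :=
    (integrable_apply_stdGaussian j).bdd_mul hf.aestronglyMeasurable
      (Filter.Eventually.of_forall hC)
  have hR : Measurable (coordReflection j) := (coordReflection j).continuous.measurable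
  have hi' : Integrable (fun u => f (coordReflection j u) * u j)
      (stdGaussian (EuclideanSpace ℝ (Fin N))) :=
    (integrable_apply_stdGaussian j).bdd_mul (hf.comp hR).aestronglyMeasurable
      (Filter.Eventually.of_forall fun u => hC _)
  have h1 : ∫ u, f u * u j ∂(stdGaussian (EuclideanSpace ℝ (Fin N))) =
      -∫ u, f (coordReflection j u) * u j ∂(stdGaussian (EuclideanSpace ℝ (Fin N))) := by
    rw [← integral_comp_coordReflection j (fun u => f u * u j), ← integral_neg]
    simp [coordReflection_apply_self]
  have h2 : ∫ u, (f u * u j - f (coordReflection j u) * u j)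
      ∂(stdGaussian (EuclideanSpace ℝ (Fin N))) ≤ 0 := by
    refine integral_nonpos fun u => ?_
    have hne : ∀ k, k ≠ j → coordReflection j u k = u k :=
      fun k hk => coordReflection_apply_of_ne hk u
    rw [← sub_mul]
    rcases le_total 0 (u j) with h | h
    · have := hanti (coordReflection j u) u (by rw [coordReflection_apply_self]; linarith) hne
      exact mul_nonpos_of_nonpos_of_nonneg (by linarith) h
    · have := hanti u (coordReflection j u) (by rw [coordReflection_apply_self]; linarith)
        fun k hk => (hne k hk).symm
      exact mul_nonpos_of_nonneg_of_nonpos (by linarith) h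
  rw [integral_sub hi hi'] at h2
  linarith

end Gaussian

/-! ### The leader, the baseline potential and the Gaussian maximum -/

section Leader

variable {N : ℕ}

/-- `i` is the first coordinate at which `y` attains its maximum. Breaking ties by the order of the
indices makes the leader unique. -/
def IsLeader (y : EuclideanSpace ℝ (Fin N)) (i : Fin N) : Prop :=
  (∀ k, y k ≤ y i) ∧ ∀ k < i, y k < y i

lemma exists_isLeader [NeZero N] (y : EuclideanSpace ℝ (Fin N)) : ∃ i, IsLeader y i := by
  classical
  obtain ⟨m, -, hm⟩ := Finset.exists_max_image Finset.univ (fun i => y i) Finset.univ_nonempty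
  have hne : (Finset.univ.filter fun i => ∀ k, y k ≤ y i).Nonempty :=
    ⟨m, by simpa using fun k => hm k (Finset.mem_univ k)⟩
  refine ⟨Finset.min' _ hne, ?_⟩
  have hmin := Finset.min'_mem _ hne
  have hmax : ∀ k, y k ≤ y (Finset.min' _ hne) := by simpa using hmin
  refine ⟨hmax, fun k hk => lt_of_le_of_ne (hmax k) fun h => ?_⟩
  have hk' : k ∈ Finset.univ.filter fun i => ∀ k, y k ≤ y i := by simpa [h] using hmax
  exact absurd (Finset.min'_le _ _ hk') (not_le.2 hk)

lemma IsLeader.unique {y : EuclideanSpace ℝ (Fin N)} {i j : Fin N} (hi : IsLeader y i)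
    (hj : IsLeader y j) : i = j := by
  rcases lt_trichotomy i j with h | h | h
  · exact absurd (hi.1 j) (not_le.2 (hj.2 i h))
  · exact h
  · exact absurd (hj.1 i) (not_le.2 (hi.2 j h))

lemma abs_apply_le_norm (v : EuclideanSpace ℝ (Fin N)) (i : Fin N) : |v i| ≤ ‖v‖ :=
  PiLp.norm_apply_le v i

lemma abs_apply_le_linftyNorm (v : EuclideanSpace ℝ (Fin N)) (i : Fin N) : |v i| ≤ linftyNorm v :=
  norm_le_pi_norm (WithLp.ofLp v) i

lemma linftyNorm_nonneg (v : EuclideanSpace ℝ (Fin N)) : 0 ≤ linftyNorm v := norm_nonneg _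

lemma linftyNorm_le_norm (v : EuclideanSpace ℝ (Fin N)) : linftyNorm v ≤ ‖v‖ :=
  (pi_norm_le_iff_of_nonneg (norm_nonneg v)).2 (abs_apply_le_norm v)

variable [NeZero N]

/-- The first coordinate at which `y` attains its maximum. -/
noncomputable def leader (y : EuclideanSpace ℝ (Fin N)) : Fin N :=
  (exists_isLeader y).choose

lemma isLeader_leader (y : EuclideanSpace ℝ (Fin N)) : IsLeader y (leader y) :=
  (exists_isLeader y).choose_spec

lemma leader_eq_iff {y : EuclideanSpace ℝ (Fin N)} {i : Fin N} : leader y = i ↔ IsLeader y i :=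
  ⟨fun h => h ▸ isLeader_leader y, fun h => (isLeader_leader y).unique h⟩

lemma apply_le_apply_leader (y : EuclideanSpace ℝ (Fin N)) (i : Fin N) : y i ≤ y (leader y) :=
  (isLeader_leader y).1 i

lemma measurable_leader : Measurable (leader : EuclideanSpace ℝ (Fin N) → Fin N) := by
  refine measurable_to_countable' fun i => ?_
  have : leader ⁻¹' {i} = {y : EuclideanSpace ℝ (Fin N) | IsLeader y i} := by
    ext y
    simp [leader_eq_iff]
  rw [this]
  have h1 : ∀ k, MeasurableSet {y : EuclideanSpace ℝ (Fin N) | y k ≤ y i} := fun k =>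
    measurableSet_le (by fun_prop) (by fun_prop)
  have h2 : ∀ k, MeasurableSet {y : EuclideanSpace ℝ (Fin N) | y k < y i} := fun k =>
    measurableSet_lt (by fun_prop) (by fun_prop)
  simp only [IsLeader, Set.ofPred_and, Set.ofPred_forall]
  exact (MeasurableSet.iInter h1).inter
    (MeasurableSet.iInter fun k => MeasurableSet.iInter fun _ => h2 k)

lemma baselinePotential_simplex (y : EuclideanSpace ℝ (Fin N)) :
    baselinePotential (simplex N) y = y (leader y) := by
  refine IsGreatest.csSup_eq ⟨⟨EuclideanSpace.single (leader y) 1, ⟨fun i => ?_, ?_⟩, ?_⟩, ?_⟩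
  · rw [PiLp.single_apply]
    split_ifs <;> norm_num
  · simp
  · simp [EuclideanSpace.inner_single_left]
  · rintro _ ⟨w, ⟨hw0, hw1⟩, rfl⟩
    simp only [PiLp.inner_apply, RCLike.inner_apply, conj_trivial]
    calc ∑ i, y i * w i ≤ ∑ i, y (leader y) * w i :=
          Finset.sum_le_sum fun i _ =>
            mul_le_mul_of_nonneg_right (apply_le_apply_leader y i) (hw0 i)
      _ = y (leader y) := by rw [← Finset.mul_sum, hw1, mul_one]

lemma apply_le_baselinePotential (y : EuclideanSpace ℝ (Fin N)) (i : Fin N) :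
    y i ≤ baselinePotential (simplex N) y :=
  (apply_le_apply_leader y i).trans_eq (baselinePotential_simplex y).symm

lemma baselinePotential_add_le (x y : EuclideanSpace ℝ (Fin N)) :
    baselinePotential (simplex N) (x + y) ≤
      baselinePotential (simplex N) x + baselinePotential (simplex N) y := by
  rw [baselinePotential_simplex (x + y), PiLp.add_apply]
  exact add_le_add (apply_le_baselinePotential _ _) (apply_le_baselinePotential _ _)

lemma baselinePotential_smul {c : ℝ} (hc : 0 ≤ c) (y : EuclideanSpace ℝ (Fin N)) :
    baselinePotential (simplex N) (c • y) = c * baselinePotential (simplex N) y := by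
  apply le_antisymm
  · rw [baselinePotential_simplex (c • y), PiLp.smul_apply, smul_eq_mul]
    exact mul_le_mul_of_nonneg_left (apply_le_baselinePotential _ _) hc
  · rw [baselinePotential_simplex y]
    exact apply_le_baselinePotential (c • y) (leader y)

/-- The vertex of the simplex at the leader is a subgradient of the baseline potential. -/
lemma baselinePotential_add_apply_leader_le (x v : EuclideanSpace ℝ (Fin N)) :
    baselinePotential (simplex N) x + v (leader x) ≤ baselinePotential (simplex N) (x + v) := by
  rw [baselinePotential_simplex x]
  exact apply_le_baselinePotential (x + v) (leader x)

lemma abs_baselinePotential_le (y : EuclideanSpace ℝ (Fin N)) :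
    |baselinePotential (simplex N) y| ≤ ‖y‖ := by
  rw [baselinePotential_simplex]
  exact abs_apply_le_norm _ _

lemma measurable_baselinePotential :
    Measurable (baselinePotential (simplex N)) := by
  have : baselinePotential (simplex N) =
      fun y => ∑ i, Set.indicator (leader ⁻¹' {i}) (fun y : EuclideanSpace ℝ (Fin N) => y i) y := by
    ext y
    rw [baselinePotential_simplex, Finset.sum_eq_single (leader y)]
    · simp
    · intro i _ hi
      simp [hi.symm]
    · simp
  rw [this]
  exact Finset.measurable_fun_sum _ fun i _ =>
    Measurable.indicator (by fun_prop) (measurable_leader (measurableSet_singleton i))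

lemma integrable_baselinePotential (Θ : EuclideanSpace ℝ (Fin N)) (η : ℝ) :
    Integrable (fun u => baselinePotential (simplex N) (Θ + η • u))
      (stdGaussian (EuclideanSpace ℝ (Fin N))) := by
  have h : Integrable (fun u => Θ + η • u) (stdGaussian (EuclideanSpace ℝ (Fin N))) :=
    (integrable_const Θ).add (IsGaussian.integrable_id.smul η)
  refine h.norm.mono' (measurable_baselinePotential.comp (by fun_prop)).aestronglyMeasurable
    (Filter.Eventually.of_forall fun u => abs_baselinePotential_le _)

variable (N) in
/-- The expected maximum of `N` independent standard Gaussian variables. -/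
noncomputable def gaussianMax : ℝ :=
  ∫ u, baselinePotential (simplex N) u ∂(stdGaussian (EuclideanSpace ℝ (Fin N)))

lemma integrable_baselinePotential_id :
    Integrable (baselinePotential (simplex N)) (stdGaussian (EuclideanSpace ℝ (Fin N))) := by
  simpa using integrable_baselinePotential (0 : EuclideanSpace ℝ (Fin N)) 1

lemma gaussianMax_nonneg : 0 ≤ gaussianMax N := by
  rw [← integral_apply_stdGaussian (0 : Fin N)]
  exact integral_mono (integrable_apply_stdGaussian 0) integrable_baselinePotential_id
    fun u => apply_le_baselinePotential u 0

/-- The Chernoff bound on the expected maximum; Jensen's inequality is used in the form of the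
tangent line bound `x ≤ log A + exp x / A - 1` with `A = N exp (r² / 2)`. -/
lemma mul_gaussianMax_le {r : ℝ} : r * gaussianMax N ≤ Real.log N + r ^ 2 / 2 := by
  have hN : (0 : ℝ) < N := by exact_mod_cast Nat.pos_of_ne_zero (NeZero.ne N)
  set A : ℝ := N * Real.exp (r ^ 2 / 2) with hA
  have hApos : 0 < A := by positivity
  have hlog : Real.log A = Real.log N + r ^ 2 / 2 := by
    rw [hA, Real.log_mul hN.ne' (Real.exp_pos _).ne', Real.log_exp]
  have hexp : ∀ i : Fin N, Integrable (fun u : EuclideanSpace ℝ (Fin N) => Real.exp (r * u i))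
      (stdGaussian (EuclideanSpace ℝ (Fin N))) := fun i =>
    (measurePreserving_apply_stdGaussian i).integrable_comp_of_integrable
      (integrable_exp_mul_gaussianReal (μ := 0) (v := 1) r)
  have hval : ∀ i : Fin N, ∫ u : EuclideanSpace ℝ (Fin N), Real.exp (r * u i)
      ∂(stdGaussian (EuclideanSpace ℝ (Fin N))) = Real.exp (r ^ 2 / 2) := by
    intro i
    have h := mgf_gaussianReal (measurePreserving_apply_stdGaussian i).map_eq r
    simpa [mgf] using h
  have hpt : ∀ u : EuclideanSpace ℝ (Fin N), r * baselinePotential (simplex N) u ≤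
      (Real.log A - 1) + (∑ i, Real.exp (r * u i)) / A := by
    intro u
    have h1 : Real.exp (r * baselinePotential (simplex N) u) ≤ ∑ i, Real.exp (r * u i) := by
      rw [baselinePotential_simplex]
      exact Finset.single_le_sum (f := fun i => Real.exp (r * u i))
        (fun i _ => (Real.exp_pos _).le) (Finset.mem_univ _)
    have h2 := Real.add_one_le_exp (r * baselinePotential (simplex N) u - Real.log A)
    rw [Real.exp_sub, Real.exp_log hApos] at h2
    have h3 : Real.exp (r * baselinePotential (simplex N) u) / A ≤
      (∑ i, Real.exp (r * u i)) / A := by gcongr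
    linarith
  have hsum : Integrable (fun u : EuclideanSpace ℝ (Fin N) => ∑ i, Real.exp (r * u i))
      (stdGaussian (EuclideanSpace ℝ (Fin N))) := integrable_finsetSum _ fun i _ => hexp i
  have h := integral_mono (integrable_baselinePotential_id.const_mul r)
    ((integrable_const (Real.log A - 1)).add (hsum.div_const A)) hpt
  simp only [Pi.add_apply] at h
  rw [integral_const_mul, integral_add (integrable_const _) (hsum.div_const A), integral_div,
    integral_finsetSum _ fun i _ => hexp i] at h
  simp only [hval, integral_const, probReal_univ, smul_eq_mul, one_mul, Finset.sum_const,
    Finset.card_univ, Fintype.card_fin, nsmul_eq_mul] at h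
  rw [← hA, div_self hApos.ne', hlog] at h
  unfold gaussianMax
  linarith

lemma gaussianMax_le : gaussianMax N ≤ √(2 * Real.log N) := by
  have hN : (1 : ℝ) ≤ N := by exact_mod_cast Nat.pos_of_ne_zero (NeZero.ne N)
  refine Real.le_sqrt_of_sq_le ?_
  -- the bound is optimal at `r = gaussianMax N`
  linarith [mul_gaussianMax_le (N := N) (r := gaussianMax N)]

end Leader

/-! ### The smoothed potential and its gradient -/

section Smoothing

variable {N : ℕ}

lemma expertsPotential_apply (η : ℝ) (Θ : EuclideanSpace ℝ (Fin N)) :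
    expertsPotential N η Θ = ∫ u, baselinePotential (simplex N) (Θ + η • u)
      ∂(stdGaussian (EuclideanSpace ℝ (Fin N))) := by
  rw [expertsPotential, gaussianSmoothing, multivariateGaussian_zero_one]

variable [NeZero N]

lemma measurable_leader_add_smul (Θ : EuclideanSpace ℝ (Fin N)) (η : ℝ) :
    Measurable fun u : EuclideanSpace ℝ (Fin N) => leader (Θ + η • u) :=
  measurable_leader.comp (by fun_prop)

lemma measurable_apply_leader (Θ v : EuclideanSpace ℝ (Fin N)) (η : ℝ) :
    Measurable fun u : EuclideanSpace ℝ (Fin N) => v (leader (Θ + η • u)) :=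
  (measurable_of_countable v).comp (measurable_leader_add_smul Θ η)

lemma integrable_apply_leader (Θ v : EuclideanSpace ℝ (Fin N)) (η : ℝ) :
    Integrable (fun u : EuclideanSpace ℝ (Fin N) => v (leader (Θ + η • u)))
      (stdGaussian (EuclideanSpace ℝ (Fin N))) :=
  Integrable.of_bound (measurable_apply_leader Θ v η).aestronglyMeasurable _
    (Filter.Eventually.of_forall fun _ => abs_apply_le_linftyNorm v _)

/-- The distribution of the leader of `Θ + η u`, for `u` standard Gaussian, as a point of the
simplex. -/
noncomputable def leaderLaw (η : ℝ) (Θ : EuclideanSpace ℝ (Fin N)) : EuclideanSpace ℝ (Fin N) :=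
  ∫ u, EuclideanSpace.single (leader (Θ + η • u)) (1 : ℝ)
    ∂(stdGaussian (EuclideanSpace ℝ (Fin N)))

lemma inner_leaderLaw (η : ℝ) (Θ v : EuclideanSpace ℝ (Fin N)) :
    ⟪leaderLaw η Θ, v⟫ = ∫ u : EuclideanSpace ℝ (Fin N), v (leader (Θ + η • u))
      ∂(stdGaussian (EuclideanSpace ℝ (Fin N))) := by
  have hint : Integrable (fun u : EuclideanSpace ℝ (Fin N) =>
      EuclideanSpace.single (leader (Θ + η • u)) (1 : ℝ))
      (stdGaussian (EuclideanSpace ℝ (Fin N))) := by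
    refine Integrable.of_bound (C := 1) (Measurable.aestronglyMeasurable ?_)
      (Filter.Eventually.of_forall fun u => by simp)
    exact (measurable_of_countable fun i : Fin N => EuclideanSpace.single i (1 : ℝ)).comp
      (measurable_leader_add_smul Θ η)
  rw [real_inner_comm, leaderLaw, ← integral_inner hint]
  simp [EuclideanSpace.inner_single_right]

lemma leaderLaw_mem_simplex (η : ℝ) (Θ : EuclideanSpace ℝ (Fin N)) :
    leaderLaw η Θ ∈ simplex N := by
  constructor
  · intro i
    have h := inner_leaderLaw η Θ (EuclideanSpace.single i 1)
    rw [EuclideanSpace.inner_single_right] at h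
    simp only [conj_trivial, one_mul] at h
    rw [h]
    refine integral_nonneg fun u => ?_
    simp only [PiLp.single_apply]
    split_ifs <;> norm_num
  · have h := inner_leaderLaw η Θ (WithLp.toLp 2 fun _ => 1)
    simpa [PiLp.inner_apply] using h

lemma inner_leaderLaw_le (η : ℝ) (Θ v : EuclideanSpace ℝ (Fin N)) :
    expertsPotential N η Θ + ⟪leaderLaw η Θ, v⟫ ≤ expertsPotential N η (Θ + v) := by
  rw [expertsPotential_apply, expertsPotential_apply, inner_leaderLaw,
    ← integral_add (integrable_baselinePotential Θ η) (integrable_apply_leader Θ v η)]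
  refine integral_mono ((integrable_baselinePotential Θ η).add (integrable_apply_leader Θ v η))
    (integrable_baselinePotential (Θ + v) η) fun u => ?_
  have h := baselinePotential_add_apply_leader_le (Θ + η • u) v
  rwa [add_right_comm] at h

lemma expertsPotential_zero {η : ℝ} (hη : 0 ≤ η) :
    expertsPotential N η 0 = η * gaussianMax N := by
  rw [expertsPotential_apply, gaussianMax, ← integral_const_mul]
  simp_rw [zero_add, baselinePotential_smul hη]

lemma expertsPotential_le_add {η η' : ℝ} (h : η ≤ η') (Θ : EuclideanSpace ℝ (Fin N)) :
    expertsPotential N η' Θ ≤ expertsPotential N η Θ + (η' - η) * gaussianMax N := by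
  rw [expertsPotential_apply, expertsPotential_apply, gaussianMax, ← integral_const_mul,
    ← integral_add (integrable_baselinePotential Θ η)
      (integrable_baselinePotential_id.const_mul _)]
  refine integral_mono (integrable_baselinePotential Θ η')
    ((integrable_baselinePotential Θ η).add (integrable_baselinePotential_id.const_mul _))
    fun u => ?_
  have h1 := baselinePotential_add_le (Θ + η • u) ((η' - η) • u)
  rwa [add_assoc, ← add_smul, add_sub_cancel, baselinePotential_smul (sub_nonneg.2 h)] at h1

/-- Jensen's inequality: smoothing by centred noise only raises the convex baseline potential. -/
lemma baselinePotential_le_expertsPotential (η : ℝ) (Θ : EuclideanSpace ℝ (Fin N)) :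
    baselinePotential (simplex N) Θ ≤ expertsPotential N η Θ := by
  have h : ∫ u : EuclideanSpace ℝ (Fin N), (Θ (leader Θ) + η * u (leader Θ))
      ∂(stdGaussian (EuclideanSpace ℝ (Fin N))) = baselinePotential (simplex N) Θ := by
    rw [integral_add (integrable_const _) ((integrable_apply_stdGaussian _).const_mul _),
      integral_const_mul, integral_apply_stdGaussian, baselinePotential_simplex]
    simp
  rw [← h, expertsPotential_apply]
  exact integral_mono
    ((integrable_const _).add ((integrable_apply_stdGaussian _).const_mul _))
    (integrable_baselinePotential Θ η) fun u => apply_le_baselinePotential (Θ + η • u) (leader Θ)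

/-- The correlation of the event that `i` leads `Θ + η u` with the noise `u_j`. Up to the factor
`1 / η` these are the entries of the Hessian of the smoothed potential. -/
noncomputable def leaderCorr (η : ℝ) (Θ : EuclideanSpace ℝ (Fin N)) (i j : Fin N) : ℝ :=
  ∫ u : EuclideanSpace ℝ (Fin N), (if leader (Θ + η • u) = i then 1 else 0) * u j
    ∂(stdGaussian (EuclideanSpace ℝ (Fin N)))

lemma measurable_ite_leader (η : ℝ) (Θ : EuclideanSpace ℝ (Fin N)) (i : Fin N) :
    Measurable fun u : EuclideanSpace ℝ (Fin N) =>
      (if leader (Θ + η • u) = i then 1 else 0 : ℝ) :=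
  (measurable_of_countable fun k : Fin N => (if k = i then 1 else 0 : ℝ)).comp
    (measurable_leader_add_smul Θ η)

lemma abs_ite_le_one (p : Prop) [Decidable p] : |(if p then 1 else 0 : ℝ)| ≤ 1 := by
  split_ifs <;> simp

lemma integrable_leaderCorr (η : ℝ) (Θ : EuclideanSpace ℝ (Fin N)) (i j : Fin N) :
    Integrable (fun u : EuclideanSpace ℝ (Fin N) =>
      (if leader (Θ + η • u) = i then 1 else 0) * u j)
      (stdGaussian (EuclideanSpace ℝ (Fin N))) :=
  (integrable_apply_stdGaussian j).bdd_mul (measurable_ite_leader η Θ i).aestronglyMeasurable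
    (Filter.Eventually.of_forall fun _ => abs_ite_le_one _)

lemma leaderCorr_nonpos {η : ℝ} (hη : 0 ≤ η) (Θ : EuclideanSpace ℝ (Fin N)) {i j : Fin N}
    (hij : i ≠ j) : leaderCorr η Θ i j ≤ 0 := by
  refine integral_mul_apply_nonpos j _ (measurable_ite_leader η Θ i)
    (fun _ => abs_ite_le_one _) fun u v hj hne => ?_
  by_cases hv : leader (Θ + η • v) = i
  · have hu : leader (Θ + η • u) = i := by
      rw [leader_eq_iff] at hv ⊢
      have hle : ∀ k, (Θ + η • u) k ≤ (Θ + η • v) k := by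
        intro k
        simp only [PiLp.add_apply, PiLp.smul_apply, smul_eq_mul]
        rcases eq_or_ne k j with rfl | hk
        · gcongr
        · rw [hne k hk]
      have heq : (Θ + η • u) i = (Θ + η • v) i := by
        simp [hne i hij]
      exact ⟨fun k => ((hle k).trans (hv.1 k)).trans_eq heq.symm,
        fun k hk => ((hle k).trans_lt (hv.2 k hk)).trans_eq heq.symm⟩
    simp [hu, hv]
  · rw [if_neg hv]
    split_ifs <;> norm_num

lemma sum_leaderCorr (η : ℝ) (Θ : EuclideanSpace ℝ (Fin N)) (j : Fin N) :
    ∑ i, leaderCorr η Θ i j = 0 := by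
  unfold leaderCorr
  rw [← integral_finsetSum _ fun i _ => integrable_leaderCorr η Θ i j]
  simp_rw [← Finset.sum_mul, Finset.sum_ite_eq, Finset.mem_univ, if_true, one_mul]
  exact integral_apply_stdGaussian j

lemma sum_leaderCorr_self_le (η : ℝ) (Θ : EuclideanSpace ℝ (Fin N)) :
    ∑ j, leaderCorr η Θ j j ≤ gaussianMax N := by
  unfold leaderCorr
  rw [← integral_finsetSum _ fun i _ => integrable_leaderCorr η Θ i i]
  refine integral_mono (integrable_finsetSum _ fun i _ => integrable_leaderCorr η Θ i i)
    integrable_baselinePotential_id fun u => ?_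
  simpa using apply_le_baselinePotential u (leader (Θ + η • u))

/-- The off-diagonal entries are nonpositive and the columns sum to zero, so that the sum of the
absolute values of all entries is twice the trace. -/
lemma sum_abs_leaderCorr_le {η : ℝ} (hη : 0 ≤ η) (Θ : EuclideanSpace ℝ (Fin N)) :
    ∑ j, ∑ i, |leaderCorr η Θ i j| ≤ 2 * gaussianMax N := by
  have hcol : ∀ j, ∑ i, |leaderCorr η Θ i j| = 2 * leaderCorr η Θ j j := by
    intro j
    have h := sum_leaderCorr η Θ j
    rw [← Finset.add_sum_erase _ _ (Finset.mem_univ j)] at h ⊢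
    have hneg : ∀ i ∈ Finset.univ.erase j, leaderCorr η Θ i j ≤ 0 := fun i hi =>
      leaderCorr_nonpos hη Θ (Finset.ne_of_mem_erase hi)
    have hsum := Finset.sum_nonpos hneg
    rw [Finset.sum_congr rfl fun i hi => abs_of_nonpos (hneg i hi), Finset.sum_neg_distrib,
      abs_of_nonneg (by linarith)]
    linarith
  simp_rw [hcol, ← Finset.mul_sum]
  exact mul_le_mul_of_nonneg_left (sum_leaderCorr_self_le η Θ) zero_le_two

lemma integral_apply_leader_mul_inner_le {η : ℝ} (hη : 0 ≤ η) (Θ v : EuclideanSpace ℝ (Fin N)) :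
    ∫ u : EuclideanSpace ℝ (Fin N), v (leader (Θ + η • u)) * ⟪v, u⟫
      ∂(stdGaussian (EuclideanSpace ℝ (Fin N))) ≤ 2 * gaussianMax N * linftyNorm v ^ 2 := by
  have hpt : ∀ u : EuclideanSpace ℝ (Fin N), v (leader (Θ + η • u)) * ⟪v, u⟫ =
      ∑ j, ∑ i, v i * v j * ((if leader (Θ + η • u) = i then 1 else 0) * u j) := by
    intro u
    simp only [PiLp.inner_apply, RCLike.inner_apply, conj_trivial, Finset.mul_sum]
    refine Finset.sum_congr rfl fun j _ => ?_
    rw [Finset.sum_eq_single (leader (Θ + η • u))]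
    · simp
      ring
    · intro i _ hi
      simp [hi.symm]
    · simp
  have hint : ∀ i j, Integrable (fun u : EuclideanSpace ℝ (Fin N) =>
      v i * v j * ((if leader (Θ + η • u) = i then 1 else 0) * u j))
      (stdGaussian (EuclideanSpace ℝ (Fin N))) := fun i j =>
    (integrable_leaderCorr η Θ i j).const_mul _
  simp_rw [hpt]
  rw [integral_finsetSum _ fun j _ => integrable_finsetSum _ fun i _ => hint i j]
  simp_rw [integral_finsetSum _ fun i _ => hint i _, integral_const_mul]
  calc ∑ j, ∑ i, v i * v j * leaderCorr η Θ i j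
      ≤ ∑ j, ∑ i, linftyNorm v ^ 2 * |leaderCorr η Θ i j| := by
        refine Finset.sum_le_sum fun j _ => Finset.sum_le_sum fun i _ => ?_
        refine (le_abs_self _).trans ?_
        rw [abs_mul, abs_mul, sq]
        gcongr
        · exact linftyNorm_nonneg v
        · exact abs_apply_le_linftyNorm v i
        · exact abs_apply_le_linftyNorm v j
    _ = linftyNorm v ^ 2 * ∑ j, ∑ i, |leaderCorr η Θ i j| := by simp_rw [Finset.mul_sum]
    _ ≤ linftyNorm v ^ 2 * (2 * gaussianMax N) := by
        gcongr
        exact sum_abs_leaderCorr_le hη Θ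
    _ = _ := by ring

lemma hasDerivAt_inner_leaderLaw {η : ℝ} (hη : 0 < η) (Θ v : EuclideanSpace ℝ (Fin N)) (s : ℝ) :
    HasDerivAt (fun s : ℝ => ⟪leaderLaw η (Θ + s • v), v⟫)
      (η⁻¹ * ∫ u : EuclideanSpace ℝ (Fin N), v (leader (Θ + s • v + η • u)) * ⟪v, u⟫
        ∂(stdGaussian (EuclideanSpace ℝ (Fin N)))) s := by
  have h := hasDerivAt_integral_comp_add_smul_stdGaussian
    (fun u => v (leader (Θ + s • v + η • u))) (measurable_apply_leader _ v η)
    (fun u => abs_apply_le_linftyNorm v _) (η⁻¹ • v)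
  -- moving `u` by `r η⁻¹ v` moves `Θ` by `r v`; recentre at `r = 0`
  have heq : (fun s : ℝ => ⟪leaderLaw η (Θ + s • v), v⟫) = fun r =>
      (fun r : ℝ => ∫ u : EuclideanSpace ℝ (Fin N),
        v (leader (Θ + s • v + η • (u + r • η⁻¹ • v)))
        ∂(stdGaussian (EuclideanSpace ℝ (Fin N)))) (r - s) := by
    ext r
    rw [inner_leaderLaw]
    have hvec : ∀ u : EuclideanSpace ℝ (Fin N),
        Θ + s • v + η • (u + (r - s) • η⁻¹ • v) = Θ + r • v + η • u := by
      intro u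
      rw [smul_add, smul_comm η, smul_smul η, mul_inv_cancel₀ hη.ne', sub_smul, one_smul]
      abel
    simp_rw [hvec]
  rw [heq]
  rw [← sub_self s] at h
  refine (h.comp_sub_const s s).congr_deriv ?_
  rw [← integral_const_mul]
  congr 1
  ext u
  rw [real_inner_smul_left]
  ring

lemma inner_leaderLaw_add_smul_le {η : ℝ} (hη : 0 < η) (Θ v : EuclideanSpace ℝ (Fin N)) {s : ℝ}
    (hs : 0 ≤ s) :
    ⟪leaderLaw η (Θ + s • v), v⟫ ≤
      ⟪leaderLaw η Θ, v⟫ + s * (2 * gaussianMax N / η * linftyNorm v ^ 2) := by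
  have hd := hasDerivAt_inner_leaderLaw hη Θ v
  have hanti : Antitone fun s : ℝ =>
      ⟪leaderLaw η (Θ + s • v), v⟫ - s * (2 * gaussianMax N / η * linftyNorm v ^ 2) := by
    refine antitone_of_hasDerivAt_nonpos
      (fun s => (hd s).sub ((hasDerivAt_id s).mul_const _)) fun s => ?_
    have h := mul_le_mul_of_nonneg_left
      (integral_apply_leader_mul_inner_le hη.le (Θ + s • v) v) (inv_pos.2 hη).le
    refine sub_nonpos.2 (h.trans_eq ?_)
    field_simp
  have h := hanti hs
  simp only [zero_smul, add_zero, zero_mul, sub_zero] at h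
  linarith

/-- The smoothed potential lies above its tangent at `Θ` by at most `⟪g' - g, v⟫`, where `g` and `g'`
are the subgradients at `Θ` and `Θ + v`, and this is at most a multiple of `‖v‖²`. -/
lemma hasGradientAt_expertsPotential {η : ℝ} (hη : 0 < η) (Θ : EuclideanSpace ℝ (Fin N)) :
    HasGradientAt (expertsPotential N η) (leaderLaw η Θ) Θ := by
  rw [hasGradientAt_iff_isLittleO_nhds_zero]
  refine Asymptotics.IsBigO.trans_isLittleO (g := fun v => ‖v‖ ^ 2)
    (Asymptotics.IsBigO.of_bound (2 * gaussianMax N / η)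
      (Filter.Eventually.of_forall fun v => ?_)) ?_
  · have h1 := inner_leaderLaw_le η Θ v
    have h2 := inner_leaderLaw_le η (Θ + v) (-v)
    have h3 := inner_leaderLaw_add_smul_le hη Θ v zero_le_one
    have h4 : linftyNorm v ^ 2 ≤ ‖v‖ ^ 2 :=
      pow_le_pow_left₀ (linftyNorm_nonneg v) (linftyNorm_le_norm v) 2
    have h5 := mul_le_mul_of_nonneg_left h4
      (div_nonneg (mul_nonneg zero_le_two gaussianMax_nonneg) hη.le : 0 ≤ 2 * gaussianMax N / η)
    rw [add_neg_cancel_right, inner_neg_right] at h2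
    rw [one_smul, one_mul] at h3
    rw [Real.norm_eq_abs, abs_of_nonneg (by linarith), Real.norm_eq_abs,
      abs_of_nonneg (by positivity)]
    linarith
  · simpa using Asymptotics.isLittleO_norm_pow_id one_lt_two

lemma expertsPotential_add_le {η : ℝ} (hη : 0 < η) (Θ v : EuclideanSpace ℝ (Fin N)) :
    expertsPotential N η (Θ + v) ≤ expertsPotential N η Θ + ⟪leaderLaw η Θ, v⟫ +
      gaussianMax N * (1 / η * linftyNorm v ^ 2) := by
  set K := 2 * gaussianMax N / η * linftyNorm v ^ 2 with hK
  have hg : ∀ s : ℝ, HasDerivAt (fun s : ℝ => expertsPotential N η (Θ + s • v))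
      ⟪leaderLaw η (Θ + s • v), v⟫ s := by
    intro s
    have h := (hasGradientAt_expertsPotential hη (Θ + s • v)).hasFDerivAt.comp_hasDerivAt s
      (((hasDerivAt_id s).smul_const v).const_add Θ)
    exact h.congr_deriv (by simp)
  have hd : ∀ s : ℝ, HasDerivAt (fun s : ℝ => expertsPotential N η (Θ + s • v) -
      s * ⟪leaderLaw η Θ, v⟫ - s ^ 2 * (K / 2))
      (⟪leaderLaw η (Θ + s • v), v⟫ - ⟪leaderLaw η Θ, v⟫ - s * K) s := by
    intro s
    refine (((hg s).sub ((hasDerivAt_id s).mul_const _)).sub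
      (((hasDerivAt_id s).pow 2).mul_const _)).congr_deriv ?_
    simp only [id, Nat.cast_ofNat]
    ring
  have hanti : AntitoneOn (fun s : ℝ => expertsPotential N η (Θ + s • v) -
      s * ⟪leaderLaw η Θ, v⟫ - s ^ 2 * (K / 2)) (Set.Ici 0) := by
    refine antitoneOn_of_hasDerivWithinAt_nonpos (convex_Ici 0)
      (fun s _ => (hd s).continuousAt.continuousWithinAt)
      (fun s _ => (hd s).hasDerivWithinAt) fun s hs => ?_
    have hs' : 0 ≤ s := (interior_subset hs : s ∈ Set.Ici (0 : ℝ))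
    linarith [inner_leaderLaw_add_smul_le hη Θ v hs']
  have h := hanti (Set.mem_Ici.2 le_rfl) (Set.mem_Ici.2 zero_le_one) zero_le_one
  simp only [zero_smul, add_zero, one_smul, zero_mul, one_mul, sub_zero, one_pow, ne_eq,
    OfNat.ofNat_ne_zero, not_false_eq_true, zero_pow] at h
  have hK2 : K / 2 = gaussianMax N * (1 / η * linftyNorm v ^ 2) := by
    rw [hK]; ring
  linarith

end Smoothing

/-! ### Regret bounds -/

section Regret

variable {N : ℕ} [NeZero N]

lemma isAdmissiblePotential_expertsPotential {η : ℝ} (hη : 0 < η) :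
    IsAdmissiblePotential (simplex N) (expertsPotential N η) :=
  ⟨fun Θ => (hasGradientAt_expertsPotential hη Θ).differentiableAt, fun Θ => by
    rw [(hasGradientAt_expertsPotential hη Θ).gradient]
    exact leaderLaw_mem_simplex η Θ⟩

/-- The potential argument. Allowing every final scale `η'` that dominates the scales used so far
lets the induction absorb the changes of scale. -/
lemma expertsPotential_sub_sum_le {T : ℕ} {η : ℕ → ℝ} (θ : ℕ → EuclideanSpace ℝ (Fin N))
    (hη : ∀ t ∈ Finset.Icc 1 T, 0 < η t) (hmono : MonotoneOn η (Set.Icc 1 T)) (n : ℕ)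
    (hn : n ≤ T) (η' : ℝ) (hη' : 0 ≤ η') (hle : ∀ t ∈ Finset.Icc 1 n, η t ≤ η') :
    expertsPotential N η' (cumReward θ n) -
        ∑ t ∈ Finset.Icc 1 n, ⟪gbpaPlay (fun t => expertsPotential N (η t)) θ t, θ t⟫ ≤
      gaussianMax N * (η' + ∑ t ∈ Finset.Icc 1 n, 1 / η t * linftyNorm (θ t) ^ 2) := by
  induction n generalizing η' with
  | zero =>
    simp [cumReward, expertsPotential_zero hη', mul_comm]
  | succ n ih =>
    have hmem : n + 1 ∈ Finset.Icc 1 T := Finset.mem_Icc.2 ⟨by omega, hn⟩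
    have hpos := hη _ hmem
    have ih' := ih (by omega) (η (n + 1)) hpos.le fun t ht => by
      rw [Finset.mem_Icc] at ht
      exact hmono ⟨ht.1, by omega⟩ ⟨by omega, hn⟩ (by omega)
    have hscale := expertsPotential_le_add (hle (n + 1) (by simp)) (cumReward θ (n + 1))
    have hdiv := expertsPotential_add_le hpos (cumReward θ n) (θ (n + 1))
    have hcum : cumReward θ (n + 1) = cumReward θ n + θ (n + 1) :=
      Finset.sum_Icc_succ_top (by omega) _
    have hplay : gbpaPlay (fun t => expertsPotential N (η t)) θ (n + 1) =
        leaderLaw (η (n + 1)) (cumReward θ n) :=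
      (hasGradientAt_expertsPotential hpos _).gradient
    rw [Finset.sum_Icc_succ_top (by omega), Finset.sum_Icc_succ_top (by omega), hplay]
    rw [hcum] at hscale ⊢
    linarith

lemma expertsRegret_le {T : ℕ} (hT : 1 ≤ T) {η : ℕ → ℝ} (θ : ℕ → EuclideanSpace ℝ (Fin N))
    (hη : ∀ t ∈ Finset.Icc 1 T, 0 < η t) (hmono : MonotoneOn η (Set.Icc 1 T)) :
    expertsRegret N T η θ ≤ √(2 * Real.log N) *
      (η T + ∑ t ∈ Finset.Icc 1 T, 1 / η t * linftyNorm (θ t) ^ 2) := by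
  have hpos := hη T (Finset.mem_Icc.2 ⟨hT, le_rfl⟩)
  have h1 := expertsPotential_sub_sum_le θ hη hmono T le_rfl (η T) hpos.le fun t ht =>
    hmono (by simpa using ht) ⟨hT, le_rfl⟩ (Finset.mem_Icc.1 ht).2
  have h2 := baselinePotential_le_expertsPotential (η T) (cumReward θ T)
  have h3 : 0 ≤ η T + ∑ t ∈ Finset.Icc 1 T, 1 / η t * linftyNorm (θ t) ^ 2 :=
    add_nonneg hpos.le (Finset.sum_nonneg fun t ht =>
      mul_nonneg (one_div_pos.2 (hη t ht)).le (sq_nonneg _))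
  have h4 := mul_le_mul_of_nonneg_right (gaussianMax_le (N := N)) h3
  unfold expertsRegret regret
  linarith

lemma expertsRegret_eq_zero {T : ℕ} (η : ℕ → ℝ) {θ : ℕ → EuclideanSpace ℝ (Fin N)}
    (hθ : ∀ t ∈ Finset.Icc 1 T, θ t = 0) : expertsRegret N T η θ = 0 := by
  have h1 : cumReward θ T = 0 := Finset.sum_eq_zero hθ
  unfold expertsRegret regret
  rw [h1, baselinePotential_simplex, Finset.sum_eq_zero fun t ht => by
    rw [hθ t ht, inner_zero_right]]
  simp

lemma expertsRegret_hindsight_le {T : ℕ} (hT : 1 ≤ T) (θ : ℕ → EuclideanSpace ℝ (Fin N)) :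
    expertsRegret N T (fun _ => √(∑ s ∈ Finset.Icc 1 T, linftyNorm (θ s) ^ 2)) θ ≤
      2 * √(2 * (∑ t ∈ Finset.Icc 1 T, linftyNorm (θ t) ^ 2) * Real.log N) := by
  set S := ∑ s ∈ Finset.Icc 1 T, linftyNorm (θ s) ^ 2 with hS
  have hS0 : 0 ≤ S := Finset.sum_nonneg fun t _ => sq_nonneg _
  rcases hS0.eq_or_lt with h0 | hpos
  -- at scale `0` the gradient need not exist, but all rewards vanish
  · have hθ : ∀ t ∈ Finset.Icc 1 T, θ t = 0 := by
      intro t ht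
      have h := (Finset.sum_eq_zero_iff_of_nonneg fun t _ => sq_nonneg _).1 (hS.symm.trans h0.symm)
        t ht
      ext i
      have h' := abs_apply_le_linftyNorm (θ t) i
      rw [pow_eq_zero_iff two_ne_zero] at h
      rw [h] at h'
      simpa using h'
    rw [expertsRegret_eq_zero _ hθ]
    positivity
  · have h := expertsRegret_le hT θ (η := fun _ => √S) (fun _ _ => Real.sqrt_pos.2 hpos)
      monotoneOn_const
    rw [← Finset.mul_sum, ← hS] at h
    refine h.trans_eq ?_
    have hdiv : 1 / √S * S = √S := by
      rw [one_div, inv_mul_eq_div, Real.div_sqrt]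
    rw [hdiv, show 2 * S * Real.log N = S * (2 * Real.log N) by ring, Real.sqrt_mul hS0]
    ring

/-- The first two terms on the right telescope. The second one is needed because the scale of a
round does not know the reward of that round. -/
lemma div_sqrt_le {x a : ℝ} (hx : 1 ≤ x) (ha : 0 ≤ a) (ha1 : a ≤ 1) :
    a / √x ≤ 2 * (√(x + a) - √x) + (1 / √x - 1 / √(x + a)) := by
  have hp : 0 < √x := Real.sqrt_pos.2 (by linarith)
  have hq : 0 < √(x + a) := Real.sqrt_pos.2 (by linarith)
  have hpq : √x ≤ √(x + a) := Real.sqrt_le_sqrt (by linarith)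
  have hsq : a = √(x + a) ^ 2 - √x ^ 2 := by
    rw [Real.sq_sqrt (by linarith), Real.sq_sqrt (by linarith)]
    ring
  have h1 : a / √(x + a) ≤ 2 * (√(x + a) - √x) := by
    rw [div_le_iff₀ hq]
    nlinarith [sq_nonneg (√(x + a) - √x)]
  have h2 : a * (1 / √x - 1 / √(x + a)) ≤ 1 / √x - 1 / √(x + a) :=
    mul_le_of_le_one_left (sub_nonneg.2 (one_div_le_one_div_of_le hp hpq)) ha1
  have h3 : a / √x = a / √(x + a) + a * (1 / √x - 1 / √(x + a)) := by ring
  linarith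

lemma sum_div_sqrt_le {a : ℕ → ℝ} (n : ℕ) (h0 : ∀ t ∈ Finset.Icc 1 n, 0 ≤ a t)
    (h1 : ∀ t ∈ Finset.Icc 1 n, a t ≤ 1) :
    ∑ t ∈ Finset.Icc 1 n, a t / √(1 + ∑ s ∈ Finset.Icc 1 (t - 1), a s) ≤
      2 * √(1 + ∑ s ∈ Finset.Icc 1 n, a s) - 1 / √(1 + ∑ s ∈ Finset.Icc 1 n, a s) - 1 := by
  induction n with
  | zero => norm_num
  | succ n ih =>
    have hsub : Finset.Icc 1 n ⊆ Finset.Icc 1 (n + 1) :=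
      Finset.Icc_subset_Icc_right (Nat.le_succ n)
    have ih' := ih (fun t ht => h0 t (hsub ht)) fun t ht => h1 t (hsub ht)
    have hmem : n + 1 ∈ Finset.Icc 1 (n + 1) := by simp
    have hx : 1 ≤ 1 + ∑ s ∈ Finset.Icc 1 n, a s :=
      le_add_of_nonneg_right (Finset.sum_nonneg fun t ht => h0 t (hsub ht))
    have h := div_sqrt_le hx (h0 _ hmem) (h1 _ hmem)
    rw [Finset.sum_Icc_succ_top (by omega), Finset.sum_Icc_succ_top (by omega),
      Nat.add_sub_cancel, ← add_assoc]
    linarith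

lemma expertsRegret_adaptive_le {T : ℕ} (hT : 1 ≤ T) (θ : ℕ → EuclideanSpace ℝ (Fin N))
    (hθ : ∀ t ∈ Finset.Icc 1 T, θ t ∈ expertsRewardSet N) :
    expertsRegret N T
        (fun t => √(2 * (1 + ∑ s ∈ Finset.Icc 1 (t - 1), linftyNorm (θ s) ^ 2))) θ ≤
      4 * √((1 + ∑ t ∈ Finset.Icc 1 T, linftyNorm (θ t) ^ 2) * Real.log N) := by
  have hsum0 : ∀ n : ℕ, 0 ≤ ∑ s ∈ Finset.Icc 1 n, linftyNorm (θ s) ^ 2 := fun n =>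
    Finset.sum_nonneg fun t _ => sq_nonneg _
  have hsum_mono : ∀ m n : ℕ, m ≤ n →
      ∑ s ∈ Finset.Icc 1 m, linftyNorm (θ s) ^ 2 ≤ ∑ s ∈ Finset.Icc 1 n, linftyNorm (θ s) ^ 2 :=
    fun m n h => Finset.sum_le_sum_of_subset_of_nonneg (Finset.Icc_subset_Icc_right h)
      fun _ _ _ => sq_nonneg _
  have h := expertsRegret_le hT θ
    (η := fun t => √(2 * (1 + ∑ s ∈ Finset.Icc 1 (t - 1), linftyNorm (θ s) ^ 2)))
    (fun t _ => Real.sqrt_pos.2 (by linarith [hsum0 (t - 1)]))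
    (fun m _ n _ hmn => Real.sqrt_le_sqrt (by
      linarith [hsum_mono (m - 1) (n - 1) (by omega)]))
  have hsum := sum_div_sqrt_le (a := fun t => linftyNorm (θ t) ^ 2) T (fun t _ => sq_nonneg _)
    fun t ht => pow_le_one₀ (linftyNorm_nonneg _) (hθ t ht)
  set S := 1 + ∑ t ∈ Finset.Icc 1 T, linftyNorm (θ t) ^ 2 with hS
  have hSpos : 0 < S := by linarith [hsum0 T]
  have hlast : √(2 * (1 + ∑ s ∈ Finset.Icc 1 (T - 1), linftyNorm (θ s) ^ 2)) ≤ √2 * √S := by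
    rw [← Real.sqrt_mul zero_le_two]
    exact Real.sqrt_le_sqrt (by linarith [hsum_mono (T - 1) T (by omega)])
  have h2 : √2 * √2 = (2 : ℝ) := Real.mul_self_sqrt zero_le_two
  have h2pos : 0 < √(2 : ℝ) := Real.sqrt_pos.2 zero_lt_two
  have hterms : ∑ t ∈ Finset.Icc 1 T,
      1 / √(2 * (1 + ∑ s ∈ Finset.Icc 1 (t - 1), linftyNorm (θ s) ^ 2)) * linftyNorm (θ t) ^ 2 ≤
      √2 * √S := by
    calc _ = 1 / √2 * ∑ t ∈ Finset.Icc 1 T, linftyNorm (θ t) ^ 2 /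
          √(1 + ∑ s ∈ Finset.Icc 1 (t - 1), linftyNorm (θ s) ^ 2) := by
          rw [Finset.mul_sum]
          refine Finset.sum_congr rfl fun t _ => ?_
          rw [Real.sqrt_mul zero_le_two]
          ring
      _ ≤ 1 / √2 * (2 * √S) := by
          have : 0 < 1 / √S := one_div_pos.2 (Real.sqrt_pos.2 hSpos)
          gcongr
          linarith
      _ = √2 * √S := by
          field_simp
          linarith
  refine h.trans ?_
  calc √(2 * Real.log N) * _ ≤ √(2 * Real.log N) * (√2 * √S + √2 * √S) := by gcongr
    _ = 4 * √(S * Real.log N) := by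
        rw [Real.sqrt_mul zero_le_two, Real.sqrt_mul hSpos.le]
        linear_combination 2 * √(Real.log N) * √S * h2

end Regret

end OnlineLinearOptimization

theorem theorem4p2 (N T : ℕ) (hN : 1 ≤ N) (hT : 1 ≤ T) :
    -- the smoothed potentials may be used by the algorithm
    (∀ η : ℝ, 0 < η →
      OnlineLinearOptimization.IsAdmissiblePotential (OnlineLinearOptimization.simplex N)
        (OnlineLinearOptimization.expertsPotential N η)) ∧
    ∀ θ : ℕ → EuclideanSpace ℝ (Fin N),
      (∀ t ∈ Finset.Icc 1 T, θ t ∈ OnlineLinearOptimization.expertsRewardSet N) →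
      -- arbitrary positive, non-decreasing scales
      (∀ η : ℕ → ℝ, (∀ t ∈ Finset.Icc 1 T, 0 < η t) → MonotoneOn η (Set.Icc 1 T) →
        OnlineLinearOptimization.expertsRegret N T η θ ≤
          √(2 * Real.log N) *
            (η T + ∑ t ∈ Finset.Icc 1 T,
              1 / η t * OnlineLinearOptimization.linftyNorm (θ t) ^ 2)) ∧
      -- the constant scale tuned in hindsight
      (OnlineLinearOptimization.expertsRegret N T
          (fun _ => √(∑ s ∈ Finset.Icc 1 T, OnlineLinearOptimization.linftyNorm (θ s) ^ 2)) θ ≤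
        2 * √(2 * (∑ t ∈ Finset.Icc 1 T, OnlineLinearOptimization.linftyNorm (θ t) ^ 2) *
          Real.log N)) ∧
      -- the adaptive scales
      (OnlineLinearOptimization.expertsRegret N T
          (fun t => √(2 * (1 + ∑ s ∈ Finset.Icc 1 (t - 1),
            OnlineLinearOptimization.linftyNorm (θ s) ^ 2))) θ ≤
        4 * √((1 + ∑ t ∈ Finset.Icc 1 T, OnlineLinearOptimization.linftyNorm (θ t) ^ 2) *
          Real.log N)) := by
  have : NeZero N := ⟨by omega⟩
  exact ⟨fun η hη => OnlineLinearOptimization.isAdmissiblePotential_expertsPotential hη,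
    fun θ hθ => ⟨fun η hη hmono => OnlineLinearOptimization.expertsRegret_le hT θ hη hmono,
      OnlineLinearOptimization.expertsRegret_hindsight_le hT θ,
      OnlineLinearOptimization.expertsRegret_adaptive_le hT θ hθ⟩⟩
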